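/- Let $\mathbb D$ be the open unit disc and let $A(\mathbb D)$ be the disk algebra, i.e. the algebra, with the sup norm, of continuous functions on $\overline{\mathbb D}$ that are holomorphic on $\mathbb D$. Let $$\varphi(z)=u\prod_{i=1}^{N}\frac{z-a_i}{1-\bar a_i z},\qquad |u|=1,\quad |a_i|<1,\quad N\ge 2,$$ be a non-trivial finite Blaschke product, and let $\alpha(f)=f\circ\varphi$ be the induced endomorphism of $A(\mathbb D)$. Let $\mathcal P$ be the algebra of formal polynomials $\sum_k U^k f_k$ with $f_k\in A(\mathbb D)$ and the commutation relation $fU=U\alpha(f)$. A pair $(A,T)$ of contractions on a complex Hilbert space with $AT=T\varphi(A)$ defines a representation $\sum_k U^kf_k\mapsto\sum_k T^kf_k(A)$ of $\mathcal P$, where $f\mapsto f(A)$ is the unique contractive unital representation of $A(\mathbb D)$ that sends the coordinate function $z$ to $A$. The norm of an element of $\mathcal P$ is the supremum of the norms of its images under all these representations, and the semicrossed product $A(\mathbb D)\times_\alpha\mathbb Z^+$ is the completion of $\mathcal P$ in this norm. Suppose that $\varphi$ is elliptic, i.e. that there is $z\in\mathbb D$ with $\varphi(z)=z$. Then $A(\mathbb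 D)\times_\alpha\mathbb Z^+$ has no nonzero quasinilpotent elements: if $F\in A(\mathbb D)\times_\alpha\mathbb Z^+$ and $\lim_{n\to\infty}\|F^n\|^{1/n}=0$, then $F=0$. -/

import Mathlib

noncomputable section

/-- The disk algebra `A(𝔻)`: the continuous functions on the closed unit disc that are holomorphic
on the open unit disc. As a subalgebra of `C(closedBall 0 1, ℂ)` it carries the sup norm. -/
def diskAlgebra : Subalgebra ℂ C(Metric.closedBall (0 : ℂ) 1, ℂ) where
  carrier := {f | ∃ g : ℂ → ℂ, DifferentiableOn ℂ g (Metric.ball 0 1) ∧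
    ∀ z : Metric.closedBall (0 : ℂ) 1, f z = g z}
  mul_mem' := by
    rintro f₁ f₂ ⟨g₁, h₁, e₁⟩ ⟨g₂, h₂, e₂⟩
    exact ⟨fun z => g₁ z * g₂ z, h₁.mul h₂, fun z => by simp [e₁, e₂]⟩
  add_mem' := by
    rintro f₁ f₂ ⟨g₁, h₁, e₁⟩ ⟨g₂, h₂, e₂⟩
    exact ⟨fun z => g₁ z + g₂ z, h₁.add h₂, fun z => by simp [e₁, e₂]⟩
  algebraMap_mem' := fun c =>
    ⟨fun _ => c, differentiableOn_const c, fun z => by simp⟩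

namespace diskAlgebra

/-- The coordinate function `z` of the disk algebra. -/
def coord : diskAlgebra :=
  ⟨⟨fun z => z, continuous_subtype_val⟩, fun z => z, differentiableOn_id, fun _ => rfl⟩

theorem norm_le_of_forall {f : diskAlgebra} {C : ℝ} (hC : 0 ≤ C)
    (h : ∀ z : Metric.closedBall (0 : ℂ) 1, ‖f.1 z‖ ≤ C) : ‖f‖ ≤ C :=
  (ContinuousMap.norm_le f.1 hC).mpr h

/-- The polynomials in `z` are dense in the disk algebra. -/
theorem mem_of_isClosed (S : Subalgebra ℂ diskAlgebra) (hS : IsClosed (S : Set diskAlgebra))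
    (hz : coord ∈ S) (f : diskAlgebra) : f ∈ S := by
  change f ∈ (S : Set diskAlgebra)
  rw [← hS.closure_eq, Metric.mem_closure_iff]
  intro ε hε
  obtain ⟨g, hg, e⟩ := f.2
  obtain ⟨δ, hδ, hf⟩ := Metric.uniformContinuous_iff.mp
    (CompactSpace.uniformContinuous_of_continuous f.1.continuous) (ε / 4) (by positivity)
  obtain ⟨η, hη, hη1⟩ : ∃ η : ℝ, 0 < η ∧ η < min δ 1 := exists_between (lt_min hδ one_pos)
  have hηδ := hη1.trans_le (min_le_left _ _)
  replace hη1 := hη1.trans_le (min_le_right _ _)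
  let R : NNReal := ⟨1 - η / 4, by linarith⟩
  let R' : NNReal := ⟨1 - η / 2, by linarith⟩
  have hRR' : (R' : ENNReal) < R := by
    rw [ENNReal.coe_lt_coe, ← NNReal.coe_lt_coe]
    change 1 - η / 2 < 1 - η / 4
    linarith
  have hR0 : 0 < R := by
    rw [← NNReal.coe_lt_coe]
    change 0 < 1 - η / 4
    linarith
  have hps := (hg.mono (Metric.closedBall_subset_ball (x := (0 : ℂ)) (ε₁ := R) (ε₂ := 1)
    (show 1 - η / 4 < 1 by linarith))).hasFPowerSeriesOnBall hR0
  obtain ⟨n, hn⟩ := (Metric.tendstoUniformlyOn_iff.mp (hps.tendstoUniformlyOn hRR')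
    (ε / 4) (by positivity)).exists
  set q := cauchyPowerSeries g 0 R
  refine ⟨∑ k ∈ Finset.range n, q.coeff k • (((1 - η : ℝ) : ℂ) • coord) ^ k,
    S.sum_mem fun k _ => S.smul_mem (S.pow_mem (S.smul_mem hz _) _) _, ?_⟩
  rw [dist_eq_norm]
  refine (norm_le_of_forall (C := ε / 2) (by positivity) fun z => ?_).trans_lt (by linarith)
  have hz1 : ‖(z : ℂ)‖ ≤ 1 := mem_closedBall_zero_iff.mp z.2
  have hr : ‖((1 - η : ℝ) : ℂ)‖ = 1 - η := by
    rw [Complex.norm_real, Real.norm_eq_abs, abs_of_pos (by linarith)]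
  have hw : ‖((1 - η : ℝ) : ℂ) * z‖ ≤ 1 - η := by
    rw [norm_mul, hr]; nlinarith [norm_nonneg (z : ℂ)]
  let w : Metric.closedBall (0 : ℂ) 1 :=
    ⟨((1 - η : ℝ) : ℂ) * z, mem_closedBall_zero_iff.mpr (by linarith)⟩
  have h1 : dist (f.1 z) (f.1 w) < ε / 4 := by
    refine hf ?_
    rw [Subtype.dist_eq, dist_eq_norm]
    have : (z : ℂ) - ((1 - η : ℝ) : ℂ) * z = (η : ℂ) * z := by push_cast; ring
    change ‖(z : ℂ) - ((1 - η : ℝ) : ℂ) * z‖ < δ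
    rw [this, norm_mul, Complex.norm_real, Real.norm_eq_abs, abs_of_pos hη]
    nlinarith [norm_nonneg (z : ℂ)]
  have h2 := hn (w : ℂ) (mem_ball_zero_iff.mpr (hw.trans_lt (show 1 - η < 1 - η / 2 by linarith)))
  rw [zero_add, ← e w] at h2
  have h3 : (f - ∑ k ∈ Finset.range n, q.coeff k • (((1 - η : ℝ) : ℂ) • coord) ^ k).1 z
      = f.1 z - q.partialSum n w := by
    have : ∀ k, (((q.coeff k • (((1 - η : ℝ) : ℂ) • coord) ^ k : diskAlgebra) :
        C(Metric.closedBall (0 : ℂ) 1, ℂ)) z) = q k fun _ => (w : ℂ) := by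
      intro k
      rw [FormalMultilinearSeries.apply_eq_pow_smul_coeff, smul_eq_mul, mul_comm]
      rfl
    simp only [FormalMultilinearSeries.partialSum, ← this]
    simp
  rw [h3, ← dist_eq_norm]
  linarith [dist_triangle (f.1 z) (f.1 w) (q.partialSum n w)]

end diskAlgebra

/-- The data of a non-constant finite Blaschke product
`φ(z) = u ∏ i, (z - a i) / (1 - conj (a i) z)` with `N ≥ 1` factors. -/
structure FiniteBlaschke where
  /-- the number of factors -/
  N : ℕ
  N_pos : 0 < N
  u : ℂ
  norm_u : ‖u‖ = 1
  a : Fin N → ℂ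
  norm_a_lt : ∀ i, ‖a i‖ < 1

namespace FiniteBlaschke

/-- The function `φ` itself. -/
def toFun (φ : FiniteBlaschke) (z : ℂ) : ℂ :=
  φ.u * ∏ i, (z - φ.a i) / (1 - (starRingEnd ℂ) (φ.a i) * z)

/-- A finite Blaschke product is elliptic if it has a fixed point in the open unit disc. -/
def IsElliptic (φ : FiniteBlaschke) : Prop :=
  ∃ z : ℂ, ‖z‖ < 1 ∧ φ.toFun z = z

theorem denom_ne_zero {a z : ℂ} (ha : ‖a‖ < 1) (hz : ‖z‖ ≤ 1) :
    1 - (starRingEnd ℂ) a * z ≠ 0 := by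
  intro h
  have h1 : (starRingEnd ℂ) a * z = 1 := (sub_eq_zero.mp h).symm
  have h2 : ‖a‖ * ‖z‖ = 1 := by
    have := congrArg norm h1
    simpa using this
  nlinarith [norm_nonneg a, norm_nonneg z]

theorem normSq_identity (a z : ℂ) :
    ‖1 - (starRingEnd ℂ) a * z‖ ^ 2 - ‖z - a‖ ^ 2 = (1 - ‖a‖ ^ 2) * (1 - ‖z‖ ^ 2) := by
  simp only [← Complex.normSq_eq_norm_sq, Complex.normSq_apply, Complex.sub_re, Complex.sub_im,
    Complex.mul_re, Complex.mul_im, Complex.conj_re, Complex.conj_im, Complex.one_re,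
    Complex.one_im]
  ring

theorem norm_factor_le {a z : ℂ} (ha : ‖a‖ < 1) (hz : ‖z‖ ≤ 1) :
    ‖(z - a) / (1 - (starRingEnd ℂ) a * z)‖ ≤ 1 := by
  rw [norm_div, div_le_one (norm_pos_iff.mpr (denom_ne_zero ha hz))]
  refine abs_le_of_sq_le_sq' ?_ (norm_nonneg _) |>.2
  have h1 : 0 ≤ (1 - ‖a‖ ^ 2) * (1 - ‖z‖ ^ 2) :=
    mul_nonneg (by nlinarith [norm_nonneg a]) (by nlinarith [norm_nonneg z])
  linarith [normSq_identity a z]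

theorem norm_factor_lt {a z : ℂ} (ha : ‖a‖ < 1) (hz : ‖z‖ < 1) :
    ‖(z - a) / (1 - (starRingEnd ℂ) a * z)‖ < 1 := by
  rw [norm_div, div_lt_one (norm_pos_iff.mpr (denom_ne_zero ha hz.le))]
  refine abs_lt_of_sq_lt_sq' ?_ (norm_nonneg _) |>.2
  have h1 : 0 < (1 - ‖a‖ ^ 2) * (1 - ‖z‖ ^ 2) :=
    mul_pos (by nlinarith [norm_nonneg a]) (by nlinarith [norm_nonneg z])
  linarith [normSq_identity a z]

theorem norm_toFun_le (φ : FiniteBlaschke) {z : ℂ} (hz : ‖z‖ ≤ 1) : ‖φ.toFun z‖ ≤ 1 := by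
  rw [toFun, norm_mul, φ.norm_u, one_mul, norm_prod]
  exact Finset.prod_le_one (fun _ _ => norm_nonneg _)
    (fun i _ => norm_factor_le (φ.norm_a_lt i) hz)

theorem norm_toFun_lt (φ : FiniteBlaschke) {z : ℂ} (hz : ‖z‖ < 1) : ‖φ.toFun z‖ < 1 := by
  rw [toFun, norm_mul, φ.norm_u, one_mul, norm_prod,
    ← Finset.mul_prod_erase Finset.univ _ (Finset.mem_univ (⟨0, φ.N_pos⟩ : Fin φ.N))]
  exact mul_lt_one_of_nonneg_of_lt_one_left (norm_nonneg _)
    (norm_factor_lt (φ.norm_a_lt _) hz)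
    (Finset.prod_le_one (fun _ _ => norm_nonneg _)
      (fun i _ => norm_factor_le (φ.norm_a_lt i) hz.le))

theorem differentiableAt_toFun (φ : FiniteBlaschke) {z : ℂ} (hz : ‖z‖ ≤ 1) :
    DifferentiableAt ℂ φ.toFun z := by
  unfold toFun
  refine DifferentiableAt.const_mul (DifferentiableAt.fun_finsetProd fun i _ => ?_) _
  exact DifferentiableAt.div (by fun_prop) (by fun_prop) (denom_ne_zero (φ.norm_a_lt i) hz)

/-- `φ` as a continuous self-map of the closed unit disc. -/
def selfMap (φ : FiniteBlaschke) : C(Metric.closedBall (0 : ℂ) 1, Metric.closedBall (0 : ℂ) 1) where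
  toFun z := ⟨φ.toFun z, by
    have hz := z.2
    rw [mem_closedBall_zero_iff] at hz ⊢
    exact φ.norm_toFun_le hz⟩
  continuous_toFun := by
    refine Continuous.subtype_mk (continuous_iff_continuousAt.mpr fun z => ?_) _
    exact ContinuousAt.comp (g := φ.toFun)
      (φ.differentiableAt_toFun (mem_closedBall_zero_iff.mp z.2)).continuousAt
      continuous_subtype_val.continuousAt

/-- The endomorphism `α(f) = f ∘ φ` of the disk algebra. -/
def endo (φ : FiniteBlaschke) : diskAlgebra →ₐ[ℂ] diskAlgebra where
  toFun f := ⟨(f : C(Metric.closedBall (0 : ℂ) 1, ℂ)).comp φ.selfMap, by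
    obtain ⟨g, hg, e⟩ := f.2
    refine ⟨g ∘ φ.toFun, hg.comp (fun z hz => ?_) (fun z hz => ?_), fun z => e _⟩
    · exact (φ.differentiableAt_toFun (mem_ball_zero_iff.mp hz).le).differentiableWithinAt
    · exact mem_ball_zero_iff.mpr (φ.norm_toFun_lt (mem_ball_zero_iff.mp hz))⟩
  map_one' := rfl
  map_mul' _ _ := rfl
  map_zero' := rfl
  map_add' _ _ := rfl
  commutes' _ := rfl

theorem norm_endo_le (φ : FiniteBlaschke) (f : diskAlgebra) : ‖φ.endo f‖ ≤ ‖f‖ :=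
  diskAlgebra.norm_le_of_forall (norm_nonneg f) fun z => f.1.norm_coe_le_norm (φ.selfMap z)

theorem continuous_endo (φ : FiniteBlaschke) : Continuous φ.endo :=
  AddMonoidHomClass.continuous_of_bound φ.endo 1 fun f => by
    rw [one_mul]; exact φ.norm_endo_le f

/-- `φ` itself, as an element of the disk algebra. -/
def toDiskAlgebra (φ : FiniteBlaschke) : diskAlgebra :=
  ⟨⟨fun z => φ.toFun z, continuous_subtype_val.comp φ.selfMap.continuous⟩, φ.toFun,
    fun _ hz => (φ.differentiableAt_toFun (mem_ball_zero_iff.mp hz).le).differentiableWithinAt,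
    fun _ => rfl⟩

end FiniteBlaschke

/-- The algebra of formal polynomials `∑ U ^ k f_k` with coefficients `f_k ∈ A(𝔻)`, subject to the
commutation relation `f U = U α(f)`, where `α(f) = f ∘ φ`. The element `∑ U ^ k f_k` is stored as
the finitely supported function `k ↦ f_k`. -/
def CovPoly (_φ : FiniteBlaschke) : Type := ℕ →₀ diskAlgebra

namespace CovPoly

variable {φ : FiniteBlaschke}

instance : AddCommGroup (CovPoly φ) := inferInstanceAs (AddCommGroup (ℕ →₀ diskAlgebra))

instance : Module ℂ (CovPoly φ) := inferInstanceAs (Module ℂ (ℕ →₀ diskAlgebra))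

/-- The monomial `U ^ k f`, as an additive map of `f`. -/
def mono (φ : FiniteBlaschke) (k : ℕ) : diskAlgebra →+ CovPoly φ :=
  Finsupp.singleAddHom k

/-- The additive map out of `CovPoly φ` with prescribed values on monomials. -/
def lift {M : Type*} [AddCommMonoid M] (h : ℕ → diskAlgebra →+ M) : CovPoly φ →+ M :=
  Finsupp.liftAddHom h

@[simp] theorem lift_mono {M : Type*} [AddCommMonoid M] (h : ℕ → diskAlgebra →+ M) (k : ℕ)
    (f : diskAlgebra) : lift h (mono φ k f) = h k f :=
  Finsupp.liftAddHom_apply_single h k f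

theorem addHom_ext' {M : Type*} [AddCommMonoid M] {h₁ h₂ : CovPoly φ →+ M}
    (h : ∀ k f, h₁ (mono φ k f) = h₂ (mono φ k f)) : h₁ = h₂ :=
  Finsupp.addHom_ext h

theorem smul_mono (c : ℂ) (k : ℕ) (f : diskAlgebra) : c • mono φ k f = mono φ k (c • f) :=
  Finsupp.smul_single c k f

/-- Multiplication, as a biadditive map: `(U ^ i f) (U ^ j g) = U ^ (i + j) (α ^ j (f) g)`. -/
def mulHom (φ : FiniteBlaschke) : CovPoly φ →+ CovPoly φ →+ CovPoly φ :=
  lift fun i => AddMonoidHom.flip (lift fun j =>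
    AddMonoidHom.mk' (fun g => (mono φ (i + j)).comp
      ((AddMonoidHom.mulRight g).comp ((φ.endo ^ j : diskAlgebra →ₐ[ℂ] diskAlgebra) :
        diskAlgebra →+ diskAlgebra)))
      (fun g₁ g₂ => by ext1 f; simp [mul_add]))

instance : Mul (CovPoly φ) := ⟨fun p q => mulHom φ p q⟩

instance : One (CovPoly φ) := ⟨mono φ 0 1⟩

theorem mul_eq (p q : CovPoly φ) : p * q = mulHom φ p q := rfl

theorem one_eq : (1 : CovPoly φ) = mono φ 0 1 := rfl

theorem mono_mul_mono (i j : ℕ) (f g : diskAlgebra) :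
    mono φ i f * mono φ j g = mono φ (i + j) ((φ.endo ^ j) f * g) := by
  simp [mul_eq, mulHom]

theorem induction {P : CovPoly φ → Prop} (p : CovPoly φ) (h0 : P 0)
    (hadd : ∀ p q, P p → P q → P (p + q)) (hm : ∀ k f, P (mono φ k f)) : P p :=
  Finsupp.induction_linear p h0 hadd hm

protected theorem left_distrib (p q r : CovPoly φ) : p * (q + r) = p * q + p * r := by
  simp [mul_eq]

protected theorem right_distrib (p q r : CovPoly φ) : (p + q) * r = p * r + q * r := by
  simp [mul_eq]

protected theorem zero_mul' (p : CovPoly φ) : 0 * p = 0 := by simp [mul_eq]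

protected theorem mul_zero' (p : CovPoly φ) : p * 0 = 0 := by simp [mul_eq]

protected theorem mul_assoc' (p q r : CovPoly φ) : p * q * r = p * (q * r) := by
  induction p using CovPoly.induction with
  | h0 => simp [CovPoly.zero_mul']
  | hadd p₁ p₂ h₁ h₂ => simp [CovPoly.right_distrib, h₁, h₂]
  | hm i f =>
    induction q using CovPoly.induction with
    | h0 => simp [CovPoly.zero_mul', CovPoly.mul_zero']
    | hadd q₁ q₂ h₁ h₂ => simp [CovPoly.right_distrib, CovPoly.left_distrib, h₁, h₂]
    | hm j g =>
      induction r using CovPoly.induction with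
      | h0 => simp [CovPoly.mul_zero']
      | hadd r₁ r₂ h₁ h₂ => simp [CovPoly.left_distrib, h₁, h₂]
      | hm k h =>
        simp only [mono_mul_mono, map_mul, add_assoc, mul_assoc]
        rw [add_comm j k, pow_add, AlgHom.mul_apply, add_comm k j]

instance : Ring (CovPoly φ) where
  __ := (inferInstance : AddCommGroup (CovPoly φ))
  mul := (· * ·)
  one := 1
  left_distrib := CovPoly.left_distrib
  right_distrib := CovPoly.right_distrib
  zero_mul := CovPoly.zero_mul'
  mul_zero := CovPoly.mul_zero'
  mul_assoc := CovPoly.mul_assoc'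
  one_mul p := by
    induction p using CovPoly.induction with
    | h0 => exact CovPoly.mul_zero' _
    | hadd p₁ p₂ h₁ h₂ => rw [CovPoly.left_distrib, h₁, h₂]
    | hm i f => rw [one_eq, mono_mul_mono, map_one, one_mul, zero_add]
  mul_one p := by
    induction p using CovPoly.induction with
    | h0 => exact CovPoly.zero_mul' _
    | hadd p₁ p₂ h₁ h₂ => rw [CovPoly.right_distrib, h₁, h₂]
    | hm i f => rw [one_eq, mono_mul_mono, mul_one, pow_zero, add_zero]; rfl

protected theorem smul_mul_assoc' (c : ℂ) (p q : CovPoly φ) : c • p * q = c • (p * q) := by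
  induction p using CovPoly.induction with
  | h0 => simp
  | hadd p₁ p₂ h₁ h₂ => simp [add_mul, h₁, h₂]
  | hm i f =>
    induction q using CovPoly.induction with
    | h0 => simp
    | hadd q₁ q₂ h₁ h₂ => simp [mul_add, h₁, h₂]
    | hm j g => simp only [smul_mono, mono_mul_mono, map_smul, smul_mul_assoc]

protected theorem mul_smul_comm' (c : ℂ) (p q : CovPoly φ) : p * c • q = c • (p * q) := by
  induction p using CovPoly.induction with
  | h0 => simp
  | hadd p₁ p₂ h₁ h₂ => simp [add_mul, h₁, h₂]
  | hm i f =>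
    induction q using CovPoly.induction with
    | h0 => simp
    | hadd q₁ q₂ h₁ h₂ => simp [mul_add, h₁, h₂]
    | hm j g => simp only [smul_mono, mono_mul_mono, mul_smul_comm]

instance : Algebra ℂ (CovPoly φ) :=
  Algebra.ofModule CovPoly.smul_mul_assoc' CovPoly.mul_smul_comm'

end CovPoly

/-- A pair `(A, T)` of contractions on a Hilbert space `H` with `A T = T φ(A)`. The map `ρ` is the
disk algebra functional calculus `f ↦ f(A)`: the unital contractive representation of `A(𝔻)` with
`ρ(z) = A`. By von Neumann's inequality and the density of polynomials in `A(𝔻)`, every contraction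
`A` has exactly one such `ρ`, so that `ρ` is not an additional choice. -/
structure CovariantPair (φ : FiniteBlaschke) (H : Type*) [NormedAddCommGroup H]
    [InnerProductSpace ℂ H] [CompleteSpace H] where
  A : H →L[ℂ] H
  T : H →L[ℂ] H
  norm_A_le : ‖A‖ ≤ 1
  norm_T_le : ‖T‖ ≤ 1
  ρ : diskAlgebra →ₐ[ℂ] (H →L[ℂ] H)
  norm_ρ_le : ∀ f, ‖ρ f‖ ≤ ‖f‖
  ρ_coord : ρ diskAlgebra.coord = A
  covariant : A * T = T * ρ φ.toDiskAlgebra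

namespace CovariantPair

variable {φ : FiniteBlaschke} {H : Type*} [NormedAddCommGroup H] [InnerProductSpace ℂ H]
  [CompleteSpace H]

theorem continuous_ρ (R : CovariantPair φ H) : Continuous R.ρ :=
  AddMonoidHomClass.continuous_of_bound R.ρ 1 fun f => by
    rw [one_mul]; exact R.norm_ρ_le f

/-- The relation `A T = T φ(A)` implies `f(A) T = T (f ∘ φ)(A)` for all `f` in the disk algebra. -/
theorem covariant_all (R : CovariantPair φ H) (f : diskAlgebra) :
    R.ρ f * R.T = R.T * R.ρ (φ.endo f) := by
  let S : Subalgebra ℂ diskAlgebra :=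
    { carrier := {f | R.ρ f * R.T = R.T * R.ρ (φ.endo f)}
      mul_mem' := by
        intro f g hf hg
        simp only [Set.mem_ofPred_eq] at hf hg ⊢
        rw [map_mul, map_mul, map_mul, mul_assoc, hg, ← mul_assoc, hf, mul_assoc]
      add_mem' := by
        intro f g hf hg
        simp only [Set.mem_ofPred_eq] at hf hg ⊢
        rw [map_add, map_add, map_add, add_mul, mul_add, hf, hg]
      algebraMap_mem' := by
        intro c
        simp only [Set.mem_ofPred_eq, AlgHom.commutes]
        exact Algebra.commutes c R.T }
  refine diskAlgebra.mem_of_isClosed S (isClosed_eq (R.continuous_ρ.mul continuous_const)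
    (continuous_const.mul (R.continuous_ρ.comp φ.continuous_endo))) ?_ f
  change R.ρ diskAlgebra.coord * R.T = R.T * R.ρ (φ.endo diskAlgebra.coord)
  rw [R.ρ_coord]
  exact R.covariant

theorem covariant_pow (R : CovariantPair φ H) (f : diskAlgebra) (j : ℕ) :
    R.ρ f * R.T ^ j = R.T ^ j * R.ρ ((φ.endo ^ j) f) := by
  induction j generalizing f with
  | zero => simp
  | succ j ih =>
    rw [pow_succ', ← mul_assoc, R.covariant_all, mul_assoc, ih, pow_succ φ.endo, AlgHom.mul_apply,
      mul_assoc]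

/-- The representation `ρ × T` of the formal polynomials: `∑ U ^ k f_k ↦ ∑ T ^ k ρ(f_k)`. -/
def rep (R : CovariantPair φ H) : CovPoly φ →+ (H →L[ℂ] H) :=
  CovPoly.lift fun k => (AddMonoidHom.mulLeft (R.T ^ k)).comp
    (R.ρ : diskAlgebra →+ (H →L[ℂ] H))

@[simp] theorem rep_mono (R : CovariantPair φ H) (k : ℕ) (f : diskAlgebra) :
    R.rep (CovPoly.mono φ k f) = R.T ^ k * R.ρ f := by
  simp [rep]

theorem rep_mul (R : CovariantPair φ H) (p q : CovPoly φ) :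
    R.rep (p * q) = R.rep p * R.rep q := by
  induction p using CovPoly.induction with
  | h0 => simp
  | hadd p₁ p₂ h₁ h₂ => simp [add_mul, h₁, h₂]
  | hm i f =>
    induction q using CovPoly.induction with
    | h0 => simp
    | hadd q₁ q₂ h₁ h₂ => simp [mul_add, h₁, h₂]
    | hm j g =>
      rw [CovPoly.mono_mul_mono, rep_mono, rep_mono, rep_mono, pow_add, map_mul, mul_assoc,
        mul_assoc, ← mul_assoc (R.ρ f), R.covariant_pow, mul_assoc]

theorem rep_smul (R : CovariantPair φ H) (c : ℂ) (p : CovPoly φ) :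
    R.rep (c • p) = c • R.rep p := by
  induction p using CovPoly.induction with
  | h0 => simp
  | hadd p₁ p₂ h₁ h₂ => simp [h₁, h₂]
  | hm i f => rw [CovPoly.smul_mono, rep_mono, rep_mono, map_smul, mul_smul_comm]

theorem norm_rep_mono_le (R : CovariantPair φ H) (k : ℕ) (f : diskAlgebra) :
    ‖R.rep (CovPoly.mono φ k f)‖ ≤ ‖f‖ := by
  rw [rep_mono]
  have hT : ∀ m : ℕ, ‖R.T ^ m‖ ≤ 1 := by
    intro m
    induction m with
    | zero => exact ContinuousLinearMap.norm_id_le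
    | succ m ih =>
      rw [pow_succ]
      exact (norm_mul_le _ _).trans (mul_le_one₀ ih (norm_nonneg _) R.norm_T_le)
  calc ‖R.T ^ k * R.ρ f‖ ≤ ‖R.T ^ k‖ * ‖R.ρ f‖ := norm_mul_le _ _
    _ ≤ 1 * ‖f‖ := mul_le_mul (hT k) (R.norm_ρ_le f) (norm_nonneg _) zero_le_one
    _ = ‖f‖ := one_mul _

end CovariantPair

namespace CovPoly

variable {φ : FiniteBlaschke}

/-- The set of the numbers `‖(ρ × T)(p)‖`, over all Hilbert spaces and all pairs of contractions
`(A, T)` with `A T = T φ(A)`. Restricting to Hilbert spaces in `Type` loses nothing, because the norm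
of an operator in the image of `ρ × T` is already attained on a separable reducing subspace. -/
def repNorms (p : CovPoly φ) : Set ℝ :=
  {r | ∃ (H : Type) (_ : NormedAddCommGroup H) (_ : InnerProductSpace ℂ H) (_ : CompleteSpace H)
    (R : CovariantPair φ H), r = ‖R.rep p‖}

/-- The norm of a formal polynomial: the supremum of the norms of its images. -/
instance : Norm (CovPoly φ) := ⟨fun p => sSup (repNorms p)⟩

theorem norm_def (p : CovPoly φ) : ‖p‖ = sSup (repNorms p) := rfl

theorem bddAbove_repNorms (p : CovPoly φ) : BddAbove (repNorms p) := by
  induction p using CovPoly.induction with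
  | h0 =>
    refine ⟨0, ?_⟩
    rintro _ ⟨H, _, _, _, R, rfl⟩
    simp
  | hadd p q hp hq =>
    obtain ⟨b, hb⟩ := hp
    obtain ⟨c, hc⟩ := hq
    refine ⟨b + c, ?_⟩
    rintro _ ⟨H, i₁, i₂, i₃, R, rfl⟩
    rw [map_add]
    exact (norm_add_le _ _).trans
      (add_le_add (hb ⟨H, i₁, i₂, i₃, R, rfl⟩) (hc ⟨H, i₁, i₂, i₃, R, rfl⟩))
  | hm k f =>
    refine ⟨‖f‖, ?_⟩
    rintro _ ⟨H, _, _, _, R, rfl⟩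
    exact R.norm_rep_mono_le k f

theorem norm_rep_le (p : CovPoly φ) {H : Type} [i₁ : NormedAddCommGroup H]
    [i₂ : InnerProductSpace ℂ H] [i₃ : CompleteSpace H] (R : CovariantPair φ H) :
    ‖R.rep p‖ ≤ ‖p‖ :=
  le_csSup (bddAbove_repNorms p) ⟨H, i₁, i₂, i₃, R, rfl⟩

protected theorem norm_nonneg' (p : CovPoly φ) : 0 ≤ ‖p‖ :=
  Real.sSup_nonneg (by rintro _ ⟨H, _, _, _, R, rfl⟩; exact norm_nonneg _)

protected theorem norm_le {p : CovPoly φ} {C : ℝ} (hC : 0 ≤ C)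
    (h : ∀ (H : Type) [NormedAddCommGroup H] [InnerProductSpace ℂ H] [CompleteSpace H]
      (R : CovariantPair φ H), ‖R.rep p‖ ≤ C) : ‖p‖ ≤ C :=
  Real.sSup_le (by rintro _ ⟨H, _, _, _, R, rfl⟩; exact h H R) hC

instance : SeminormedRing (CovPoly φ) :=
  { (inferInstance : Ring (CovPoly φ)),
    SeminormedAddCommGroup.ofCore (𝕜 := ℂ)
      { norm_nonneg := CovPoly.norm_nonneg'
        norm_smul := by
          have key : ∀ (c : ℂ) (p : CovPoly φ), ‖c • p‖ ≤ ‖c‖ * ‖p‖ := fun c p =>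
            CovPoly.norm_le (mul_nonneg (norm_nonneg c) p.norm_nonneg') fun H _ _ _ R => by
              rw [R.rep_smul, norm_smul]
              exact mul_le_mul_of_nonneg_left (norm_rep_le p R) (norm_nonneg c)
          intro c p
          refine le_antisymm (key c p) ?_
          rcases eq_or_ne c 0 with rfl | hc
          · simpa using CovPoly.norm_nonneg' ((0 : ℂ) • p)
          · have h := key c⁻¹ (c • p)
            rw [inv_smul_smul₀ hc, norm_inv] at h
            rwa [← le_inv_mul_iff₀ (norm_pos_iff.mpr hc)]
        norm_triangle := fun p q =>
          CovPoly.norm_le (add_nonneg p.norm_nonneg' q.norm_nonneg') fun H _ _ _ R => by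
            rw [map_add]
            exact (norm_add_le _ _).trans (add_le_add (norm_rep_le p R) (norm_rep_le q R)) } with
    norm_mul_le := fun p q =>
      CovPoly.norm_le (mul_nonneg p.norm_nonneg' q.norm_nonneg') fun H _ _ _ R => by
        rw [R.rep_mul]
        exact (norm_mul_le _ _).trans
          (mul_le_mul (norm_rep_le p R) (norm_rep_le q R) (norm_nonneg _) p.norm_nonneg') }

instance : NormedSpace ℂ (CovPoly φ) where
  norm_smul_le c p :=
    CovPoly.norm_le (mul_nonneg (norm_nonneg c) p.norm_nonneg') fun H _ _ _ R => by
      rw [R.rep_smul, norm_smul]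
      exact mul_le_mul_of_nonneg_left (norm_rep_le p R) (norm_nonneg c)

end CovPoly

/-- The semicrossed product `A(𝔻) ×_α ℤ⁺`: the completion of the formal polynomials in the norm
above. It is a Banach algebra. -/
abbrev SemicrossedProduct (φ : FiniteBlaschke) : Type := UniformSpace.Completion (CovPoly φ)

/-- An element `x` of a normed ring is quasinilpotent if `lim ‖x ^ n‖ ^ (1 / n) = 0`. -/
def IsQuasinilpotent {B : Type*} [NormedRing B] (x : B) : Prop :=
  Filter.Tendsto (fun n : ℕ => ‖x ^ n‖ ^ (1 / (n : ℝ))) Filter.atTop (nhds 0)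

end

/-! Every element `F` of the semicrossed product has Fourier coefficients `f_k` in the disk algebra.
They are contractive functions of `F`, and they determine `F`. If `F ≠ 0`, let `k` be the least
index with `g = f_k ≠ 0`. The coefficient of index `n * k` of `F ^ n` is then the single product of
the functions `g ∘ φ^[i * k]`, `i < n`, so the sup norm of this product is a lower bound for `‖F ^
n‖`. It suffices to bound it below by `c ^ n` with `c > 0` independent of `n`.

Ellipticity gives this bound. Let `z₀` be a fixed point in the open disc and write `g = (z - z₀) ^ m
* h` with `h z₀ ≠ 0`. The product of the `h ∘ φ^[i * k]` has the value `h z₀ ^ n` at `z₀`, so by the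
maximum principle it is at least that large in modulus somewhere on the unit circle. Since `φ`
preserves the circle, each factor `φ^[i * k] - z₀` has modulus at least `1 - |z₀|` there. Hence `c =
(1 - |z₀|) ^ m * |h z₀|` works (`exists_pow_le_norm_prod`).

Contractivity of the coefficients comes from finite-dimensional covariant pairs, a diagonal matrix
along an orbit of `φ` together with a shift (`orbitPair`). Uniqueness is an Abel summation argument,
based on the contractive maps `U ↦ r U` (`gauge`). -/

noncomputable section

/-! ### Completeness of the disk algebra -/

/-- The disk algebra is closed under uniform limits. -/
theorem diskAlgebra.isClosed :
    IsClosed (diskAlgebra : Set C(Metric.closedBall (0 : ℂ) 1, ℂ)) := by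
  refine isClosed_of_closure_subset fun f hf => ?_
  obtain ⟨u, hu, hlim⟩ := mem_closure_iff_seq_limit.mp hf
  choose g hg e using hu
  classical
  -- The value off the closed disc is irrelevant: holomorphy is required only on the open disc.
  let G : ℂ → ℂ := fun z =>
    if hz : z ∈ Metric.closedBall (0 : ℂ) 1 then f ⟨z, hz⟩ else 0
  refine ⟨G, ?_, fun z => by simp only [G, dif_pos z.2]⟩
  have hunif : TendstoUniformlyOn g G Filter.atTop (Metric.ball 0 1) := by
    rw [Metric.tendstoUniformlyOn_iff]
    intro ε hε
    filter_upwards [(Metric.tendsto_nhds.mp hlim) ε hε] with n hn z hz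
    have hz' := Metric.ball_subset_closedBall hz
    simp only [G, dif_pos hz']
    rw [← e n ⟨z, hz'⟩, dist_comm]
    exact (ContinuousMap.dist_apply_le_dist _).trans_lt hn
  exact hunif.tendstoLocallyUniformlyOn.differentiableOn (Filter.Eventually.of_forall hg)
    Metric.isOpen_ball

/-- Completeness lets the coefficient maps extend from formal polynomials to their completion. -/
instance : CompleteSpace diskAlgebra := diskAlgebra.isClosed.completeSpace_coe

/-! ### Finite-dimensional covariant pairs along orbits -/

namespace FiniteBlaschke

theorem continuous_endo_pow (φ : FiniteBlaschke) (j : ℕ) :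
    Continuous (φ.endo ^ j : diskAlgebra →ₐ[ℂ] diskAlgebra) := by
  rw [AlgHom.coe_pow]
  exact φ.continuous_endo.iterate j

/-- The lower shift matrix of size `k + 1`. -/
def shiftMatrix (k : ℕ) : Matrix (Fin (k + 1)) (Fin (k + 1)) ℂ :=
  Matrix.of fun i j => if (i : ℕ) = j + 1 then 1 else 0

/-- The shift moves each basis vector to the next, so its `j`-th power sends `e_0` to `e_j`, and to
`0` once `j > k`. -/
theorem shiftMatrix_pow_apply_zero (k j : ℕ) (i : Fin (k + 1)) :
    (shiftMatrix k ^ j) i 0 = if (i : ℕ) = j then 1 else 0 := by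
  induction j generalizing i with
  | zero =>
    rw [pow_zero, Matrix.one_apply]
    exact if_congr Fin.ext_iff rfl rfl
  | succ j ih =>
    rw [pow_succ', Matrix.mul_apply]
    simp only [ih, mul_ite, mul_one, mul_zero]
    simp only [shiftMatrix, Matrix.of_apply]
    by_cases hi : (i : ℕ) = j + 1
    · rw [if_pos hi, Finset.sum_eq_single (⟨j, by omega⟩ : Fin (k + 1))]
      · simp [hi]
      · intro b _ hb
        rw [if_neg fun h => hb (Fin.ext h)]
      · simp
    · rw [if_neg hi]
      refine Finset.sum_eq_zero fun b _ => ?_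
      split_ifs <;> first | rfl | omega

-- The shift `S` is a partial isometry: `S* S` is the diagonal projection that kills only the last
-- basis vector. The C*-identity then bounds `‖S‖`.
open scoped Matrix.Norms.L2Operator in
theorem norm_shiftMatrix_le (k : ℕ) : ‖shiftMatrix k‖ ≤ 1 := by
  have h : (shiftMatrix k).conjTranspose * shiftMatrix k =
      Matrix.diagonal fun i : Fin (k + 1) => if (i : ℕ) < k then (1 : ℂ) else 0 := by
    ext i j
    simp only [Matrix.mul_apply, Matrix.conjTranspose_apply, shiftMatrix, Matrix.of_apply,
      Matrix.diagonal_apply, mul_ite, mul_one, mul_zero, Fin.ext_iff]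
    by_cases hj : (j : ℕ) < k
    · rw [Finset.sum_eq_single (⟨j + 1, by omega⟩ : Fin (k + 1))]
      · by_cases hij : (i : ℕ) = j
        · simp [hij, hj]
        · simp [hij, Ne.symm hij]
      · intro b _ hb
        rw [if_neg fun h => hb (Fin.ext h)]
      · simp
    · rw [Finset.sum_eq_zero]
      · split_ifs <;> first | rfl | omega
      · intro b _
        rw [if_neg (by omega)]
  have h1 : ‖shiftMatrix k‖ * ‖shiftMatrix k‖ ≤ 1 := by
    rw [← Matrix.l2_opNorm_conjTranspose_mul_self, h, Matrix.l2_opNorm_diagonal]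
    refine (pi_norm_le_iff_of_nonneg zero_le_one).mpr fun i => ?_
    split_ifs <;> simp
  nlinarith [norm_nonneg (shiftMatrix k)]

/-- The diagonal representation of the disk algebra given by the first `k + 1` points of the orbit
of `x` under `φ`. -/
def orbitRep (φ : FiniteBlaschke) (k : ℕ) (x : Metric.closedBall (0 : ℂ) 1) :
    diskAlgebra →ₐ[ℂ]
      (EuclideanSpace ℂ (Fin (k + 1)) →L[ℂ] EuclideanSpace ℂ (Fin (k + 1))) :=
  (Matrix.toEuclideanCLM (n := Fin (k + 1)) (𝕜 := ℂ)).toAlgEquiv.toAlgHom.comp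
    ((Matrix.diagonalAlgHom ℂ).comp
      (AlgHom.pi fun i : Fin (k + 1) =>
        (ContinuousMap.evalAlgHom ℂ ℂ (φ.selfMap^[(i : ℕ)] x)).comp diskAlgebra.val))

theorem orbitRep_apply (φ : FiniteBlaschke) (k : ℕ) (x : Metric.closedBall (0 : ℂ) 1)
    (f : diskAlgebra) : φ.orbitRep k x f = Matrix.toEuclideanCLM (n := Fin (k + 1)) (𝕜 := ℂ)
      (Matrix.diagonal fun i => f.1 (φ.selfMap^[(i : ℕ)] x)) := rfl

theorem norm_orbitRep_le (φ : FiniteBlaschke) (k : ℕ) (x : Metric.closedBall (0 : ℂ) 1)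
    (f : diskAlgebra) : ‖φ.orbitRep k x f‖ ≤ ‖f‖ := by
  rw [orbitRep_apply, Matrix.l2_opNorm_toEuclideanCLM, Matrix.l2_opNorm_diagonal]
  exact (pi_norm_le_iff_of_nonneg (norm_nonneg f)).mpr fun i => f.1.norm_coe_le_norm _

/-- The covariant pair on `ℂ ^ (k + 1)` in which `A` is diagonal, with entries the first `k + 1`
points of the orbit of `x`, and `T` is the shift. -/
def orbitPair (φ : FiniteBlaschke) (k : ℕ) (x : Metric.closedBall (0 : ℂ) 1) :
    CovariantPair φ (EuclideanSpace ℂ (Fin (k + 1))) where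
  A := φ.orbitRep k x diskAlgebra.coord
  T := Matrix.toEuclideanCLM (n := Fin (k + 1)) (𝕜 := ℂ) (shiftMatrix k)
  norm_A_le := (φ.norm_orbitRep_le k x _).trans <|
    diskAlgebra.norm_le_of_forall zero_le_one fun z => mem_closedBall_zero_iff.mp z.2
  norm_T_le := by
    rw [Matrix.l2_opNorm_toEuclideanCLM]
    exact norm_shiftMatrix_le k
  ρ := φ.orbitRep k x
  norm_ρ_le := φ.norm_orbitRep_le k x
  ρ_coord := rfl
  covariant := by
    rw [orbitRep_apply, orbitRep_apply, ← map_mul, ← map_mul]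
    congr 1
    ext i j
    rw [Matrix.diagonal_mul, Matrix.mul_diagonal]
    simp only [shiftMatrix, Matrix.of_apply, mul_ite, mul_one, mul_zero, ite_mul, one_mul, zero_mul]
    -- Only the entries with `i = j + 1` survive. There the relation says that the orbit point of
    -- index `j + 1` is the image under `φ` of the one of index `j`.
    split_ifs with h
    · rw [h, Function.iterate_succ_apply']
      rfl
    · rfl

end FiniteBlaschke

/-! ### Coefficients of formal polynomials -/

namespace CovPoly

variable {φ : FiniteBlaschke}

/-- The coefficient `f_k` of `∑ U ^ k f_k`. -/
def coeff (φ : FiniteBlaschke) (k : ℕ) : CovPoly φ →+ diskAlgebra := Finsupp.applyAddHom k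

theorem coeff_mono (k j : ℕ) (f : diskAlgebra) :
    coeff φ k (mono φ j f) = if j = k then f else 0 :=
  Finsupp.single_apply

/-- Since `e_0` is an eigenvector of `f(A)` with eigenvalue `f x`, the monomial `U ^ j f` sends it
to `f x • e_j`. The last coordinate therefore isolates `j = k`. -/
theorem orbitPair_rep_apply (k : ℕ) (x : Metric.closedBall (0 : ℂ) 1) (p : CovPoly φ) :
    ((φ.orbitPair k x).rep p (EuclideanSpace.single 0 1)) (Fin.last k) = (coeff φ k p).1 x := by
  induction p using CovPoly.induction with
  | h0 => simp
  | hadd p q hp hq => simp [hp, hq]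
  | hm j f =>
    rw [CovariantPair.rep_mono, coeff_mono]
    change ((Matrix.toEuclideanCLM (n := Fin (k + 1)) (𝕜 := ℂ) (FiniteBlaschke.shiftMatrix k)) ^ j *
      φ.orbitRep k x f) _ _ = _
    rw [FiniteBlaschke.orbitRep_apply, ← map_pow, ← map_mul, Matrix.ofLp_toEuclideanCLM]
    have h0 : (EuclideanSpace.single 0 1 : EuclideanSpace ℂ (Fin (k + 1))).ofLp =
        Pi.single 0 1 := rfl
    rw [h0, Matrix.mulVec_single_one, Matrix.col_apply, Matrix.mul_diagonal,
      FiniteBlaschke.shiftMatrix_pow_apply_zero]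
    rcases eq_or_ne k j with rfl | h
    · simp
    · simp [h, h.symm]

/-- The coefficients of a formal polynomial are bounded by its norm. -/
theorem norm_coeff_le (k : ℕ) (p : CovPoly φ) : ‖coeff φ k p‖ ≤ ‖p‖ := by
  refine diskAlgebra.norm_le_of_forall p.norm_nonneg' fun x => ?_
  -- The value of the coefficient at `x` is a matrix entry, hence at most the operator norm.
  rw [← orbitPair_rep_apply]
  refine (PiLp.norm_apply_le _ _).trans ((ContinuousLinearMap.le_opNorm _ _).trans ?_)
  simpa using norm_rep_le p (φ.orbitPair k x)

theorem continuous_coeff (k : ℕ) : Continuous (coeff φ k) :=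
  AddMonoidHomClass.continuous_of_bound (coeff φ k) 1 fun p => by
    rw [one_mul]; exact norm_coeff_le k p

theorem coeff_mul (n : ℕ) (p q : CovPoly φ) :
    coeff φ n (p * q) =
      ∑ ij ∈ Finset.HasAntidiagonal.antidiagonal n, (φ.endo ^ ij.2) (coeff φ ij.1 p) * coeff φ ij.2 q := by
  induction p using CovPoly.induction with
  | h0 => simp
  | hadd p₁ p₂ h₁ h₂ => simp [add_mul, h₁, h₂, Finset.sum_add_distrib]
  | hm i f =>
    induction q using CovPoly.induction with
    | h0 => simp
    | hadd q₁ q₂ h₁ h₂ => simp [mul_add, h₁, h₂, Finset.sum_add_distrib]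
    | hm j g =>
      rw [mono_mul_mono, coeff_mono]
      simp only [coeff_mono]
      split_ifs with h
      · rw [Finset.sum_eq_single (i, j)]
        · simp
        · rintro ⟨a, b⟩ _ hab
          by_cases ha : i = a
          · have hb : j ≠ b := fun hb => hab (by rw [ha, hb])
            simp [hb]
          · simp [ha]
        · intro h'
          exact absurd (Finset.HasAntidiagonal.mem_antidiagonal.mpr h) h'
      · symm
        refine Finset.sum_eq_zero ?_
        rintro ⟨a, b⟩ hab
        by_cases ha : i = a
        · have hb : j ≠ b := fun hb => h (by rw [ha, hb]; exact Finset.HasAntidiagonal.mem_antidiagonal.mp hab)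
          simp [hb]
        · simp [ha]

end CovPoly

/-! ### Gauge maps and Abel summation -/

namespace CovariantPair

variable {φ : FiniteBlaschke} {H : Type*} [NormedAddCommGroup H] [InnerProductSpace ℂ H]
  [CompleteSpace H]

/-- If `(A, T)` is a covariant pair, then so is `(A, r T)` for `|r| ≤ 1`. -/
def scale (R : CovariantPair φ H) (r : ℂ) (hr : ‖r‖ ≤ 1) : CovariantPair φ H where
  A := R.A
  T := r • R.T
  norm_A_le := R.norm_A_le
  norm_T_le := by
    rw [norm_smul]
    exact mul_le_one₀ hr (norm_nonneg _) R.norm_T_le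
  ρ := R.ρ
  norm_ρ_le := R.norm_ρ_le
  ρ_coord := R.ρ_coord
  covariant := by rw [mul_smul_comm, smul_mul_assoc, R.covariant]

end CovariantPair

namespace CovPoly

variable {φ : FiniteBlaschke}

theorem norm_mono_le (k : ℕ) (f : diskAlgebra) : ‖mono φ k f‖ ≤ ‖f‖ :=
  CovPoly.norm_le (norm_nonneg f) fun _ _ _ _ R => R.norm_rep_mono_le k f

/-- The map `∑ U ^ k f_k ↦ ∑ r ^ k U ^ k f_k`. -/
def gauge (φ : FiniteBlaschke) (r : ℂ) : CovPoly φ →+ CovPoly φ :=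
  lift fun k => (mono φ k).comp (DistribSMul.toAddMonoidHom diskAlgebra (r ^ k))

theorem gauge_mono (r : ℂ) (k : ℕ) (f : diskAlgebra) :
    gauge φ r (mono φ k f) = mono φ k (r ^ k • f) := by
  simp [gauge]

/-- The supremum defining the norm also runs over the scaled pairs, so this identity makes `gauge`
contractive. -/
theorem rep_gauge {H : Type*} [NormedAddCommGroup H] [InnerProductSpace ℂ H] [CompleteSpace H]
    (R : CovariantPair φ H) (r : ℂ) (hr : ‖r‖ ≤ 1) (p : CovPoly φ) :
    R.rep (gauge φ r p) = (R.scale r hr).rep p := by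
  induction p using CovPoly.induction with
  | h0 => simp
  | hadd p q hp hq => simp [hp, hq]
  | hm k f =>
    rw [gauge_mono, CovariantPair.rep_mono, CovariantPair.rep_mono]
    change _ = (r • R.T) ^ k * R.ρ f
    rw [map_smul, mul_smul_comm, smul_pow, smul_mul_assoc]

theorem norm_gauge_le (r : ℂ) (hr : ‖r‖ ≤ 1) (p : CovPoly φ) : ‖gauge φ r p‖ ≤ ‖p‖ :=
  CovPoly.norm_le p.norm_nonneg' fun _ _ _ _ R => by
    rw [rep_gauge R r hr]
    exact norm_rep_le p _

theorem gauge_eq_sum (r : ℂ) (p : CovPoly φ) :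
    ∃ s : Finset ℕ, gauge φ r p = ∑ k ∈ s, mono φ k (r ^ k • coeff φ k p) := ⟨Finsupp.support p, Finsupp.liftAddHom_apply _ p⟩

/-- The damping factors `r ^ k` turn a uniform bound on the coefficients into a geometric series, so
the estimate does not depend on the degree of `p`. -/
theorem norm_gauge_le_of_coeff {r : ℝ} (h0 : 0 ≤ r) (h1 : r < 1) (p : CovPoly φ) {ε : ℝ}
    (hε : 0 ≤ ε) (h : ∀ k, ‖coeff φ k p‖ ≤ ε) : ‖gauge φ r p‖ ≤ ε * (1 - r)⁻¹ := by
  obtain ⟨s, hs⟩ := gauge_eq_sum (φ := φ) (r : ℂ) p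
  rw [hs, ← tsum_geometric_of_lt_one h0 h1]
  calc ‖∑ k ∈ s, mono φ k ((r : ℂ) ^ k • coeff φ k p)‖
      ≤ ∑ k ∈ s, ε * r ^ k := by
        refine norm_sum_le_of_le _ fun k _ => (norm_mono_le k _).trans ?_
        rw [norm_smul, norm_pow, Complex.norm_real, Real.norm_of_nonneg h0, mul_comm]
        exact mul_le_mul_of_nonneg_right (h k) (by positivity)
    _ = ε * ∑ k ∈ s, r ^ k := by rw [Finset.mul_sum]
    _ ≤ ε * ∑' k, r ^ k := mul_le_mul_of_nonneg_left
        ((summable_geometric_of_lt_one h0 h1).sum_le_tsum s fun k _ => by positivity) hε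

theorem tendsto_gauge (p : CovPoly φ) :
    Filter.Tendsto (fun r : ℝ => ‖p - gauge φ (r : ℂ) p‖) (nhds 1) (nhds 0) := by
  induction p using CovPoly.induction with
  | h0 => simp
  | hadd p q hp hq =>
    refine squeeze_zero (fun _ => norm_nonneg _) (fun r => ?_) (by simpa using hp.add hq)
    rw [map_add, add_sub_add_comm]
    exact norm_add_le _ _
  | hm k f =>
    have h : Filter.Tendsto (fun r : ℝ => ‖f - ((r : ℂ) ^ k • f)‖) (nhds 1) (nhds 0) := by
      have hc : Continuous fun r : ℝ => ‖f - ((r : ℂ) ^ k • f)‖ := by fun_prop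
      have h1 : ‖f - (((1 : ℝ) : ℂ) ^ k • f)‖ = 0 := by
        rw [Complex.ofReal_one, one_pow, one_smul, sub_self, norm_zero]
      rw [← h1]
      exact hc.tendsto 1
    refine squeeze_zero (fun _ => norm_nonneg _) (fun r => ?_) h
    rw [gauge_mono, ← map_sub]
    exact norm_mono_le k _

end CovPoly

/-! ### Fourier coefficients in the semicrossed product -/

namespace SemicrossedProduct

variable {φ : FiniteBlaschke}

/-- The Fourier coefficients of an element of the semicrossed product. -/
def coeff (φ : FiniteBlaschke) (k : ℕ) : SemicrossedProduct φ →+ diskAlgebra :=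
  (CovPoly.coeff φ k).extension (CovPoly.continuous_coeff k)

theorem continuous_coeff (k : ℕ) : Continuous (coeff φ k) :=
  UniformSpace.Completion.continuous_extension

theorem coeff_coe (k : ℕ) (p : CovPoly φ) :
    coeff φ k (p : SemicrossedProduct φ) = CovPoly.coeff φ k p :=
  AddMonoidHom.extension_coe _ (CovPoly.continuous_coeff k) p

theorem norm_coeff_le (k : ℕ) (F : SemicrossedProduct φ) : ‖coeff φ k F‖ ≤ ‖F‖ := by
  induction F using UniformSpace.Completion.induction_on with
  | hp => exact isClosed_le (continuous_coeff k).norm continuous_norm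
  | ih p =>
    rw [coeff_coe, UniformSpace.Completion.norm_coe]
    exact CovPoly.norm_coeff_le k p

theorem coeff_mul (n : ℕ) (F G : SemicrossedProduct φ) :
    coeff φ n (F * G) = ∑ ij ∈ Finset.HasAntidiagonal.antidiagonal n,
      (φ.endo ^ ij.2) (coeff φ ij.1 F) * coeff φ ij.2 G := by
  induction F, G using UniformSpace.Completion.induction_on₂ with
  | hp =>
    refine isClosed_eq ((continuous_coeff n).comp continuous_mul)
      (continuous_finsetSum _ fun ij _ => ?_)
    exact ((φ.continuous_endo_pow ij.2).comp ((continuous_coeff ij.1).comp continuous_fst)).mul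
      ((continuous_coeff ij.2).comp continuous_snd)
  | ih p q =>
    rw [← UniformSpace.Completion.coe_mul]
    simp only [coeff_coe, CovPoly.coeff_mul]

theorem coeff_one (k : ℕ) : coeff φ k 1 = if k = 0 then 1 else 0 := by
  rw [← UniformSpace.Completion.coe_one, coeff_coe, CovPoly.one_eq, CovPoly.coeff_mono]
  simp only [eq_comm]

/-- The lowest coefficient of a power. -/
theorem coeff_pow {F : SemicrossedProduct φ} {k : ℕ} (h : ∀ j < k, coeff φ j F = 0) (n : ℕ) :
    (∀ j < n * k, coeff φ j (F ^ n) = 0) ∧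
      coeff φ (n * k) (F ^ n) = ∏ i ∈ Finset.range n, (φ.endo ^ (i * k)) (coeff φ k F) := by
  induction n with
  | zero => simp [coeff_one]
  | succ n ih =>
    constructor
    · intro j hj
      -- In `F * F ^ n`, a term of bidegree `(a, b)` with `a + b < (n + 1) * k` has `a < k` or `b <
      -- n * k`, so one of its factors vanishes.
      rw [pow_succ', coeff_mul]
      refine Finset.sum_eq_zero ?_
      rintro ⟨a, b⟩ hab
      rw [Finset.HasAntidiagonal.mem_antidiagonal] at hab
      rw [Nat.succ_mul] at hj
      by_cases ha : a < k
      · simp [h a ha]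
      · have hb : b < n * k := by
          dsimp only at hab
          omega
        simp [ih.1 b hb]
    -- In total degree `(n + 1) * k` only the bidegree `(k, n * k)` survives. Moving `f_k` past `U ^
    -- (n * k)` produces the new factor, of index `i = n`.
    · rw [pow_succ', coeff_mul, Finset.sum_eq_single (k, n * k)]
      · rw [ih.2, Finset.prod_range_succ, mul_comm]
      · rintro ⟨a, b⟩ hab hne
        rw [Finset.HasAntidiagonal.mem_antidiagonal] at hab
        dsimp only at hab
        rw [Nat.succ_mul] at hab
        by_cases ha : a < k
        · simp [h a ha]
        · have hb : b < n * k := by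
            rcases lt_or_ge b (n * k) with hb | hb
            · exact hb
            · exact absurd (Prod.ext (by dsimp only; omega) (by dsimp only; omega)) hne
          simp [ih.1 b hb]
      · intro h'
        refine absurd (Finset.HasAntidiagonal.mem_antidiagonal.mpr ?_) h'
        dsimp only
        rw [Nat.succ_mul, add_comm]

/-- An element of the semicrossed product is determined by its Fourier coefficients. -/
theorem eq_zero_of_coeff_eq_zero {F : SemicrossedProduct φ} (h : ∀ k, coeff φ k F = 0) :
    F = 0 := by
  have happrox : ∀ ε > 0, ∃ p : CovPoly φ, ‖F - p‖ < ε := fun ε hε => by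
    obtain ⟨_, ⟨p, rfl⟩, hp⟩ := Metric.mem_closure_iff.mp
      (UniformSpace.Completion.denseRange_coe (α := CovPoly φ) F) ε hε
    exact ⟨p, by rwa [← dist_eq_norm]⟩
  have hnorm : ∀ p q : CovPoly φ, ‖p - q‖ ≤ ‖F - p‖ + ‖F - q‖ := fun p q => by
    rw [← UniformSpace.Completion.norm_coe, UniformSpace.Completion.coe_sub, norm_sub_rev F p]
    exact norm_sub_le_norm_sub_add_norm_sub _ _ _
  refine norm_le_zero_iff.mp (le_of_forall_pos_le_add fun ε hε => ?_)
  -- The order of choices matters: `q` approximates `F`, then `r < 1` is adapted to `q`, and only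
  -- then `p` approximates `F` with an accuracy depending on `r`. The five errors are `F - q`, `q -
  -- gauge q`, two from `gauge (q - p)`, and `gauge p`.
  obtain ⟨q, hq⟩ := happrox (ε / 5) (by positivity)
  obtain ⟨r, ⟨hr0, hr1⟩, hr⟩ : ∃ r : ℝ, (0 < r ∧ r < 1) ∧
      ‖q - CovPoly.gauge φ (r : ℂ) q‖ < ε / 5 := by
    have h1 := (CovPoly.tendsto_gauge q).mono_left (nhdsWithin_le_nhds (s := Set.Iio 1))
    have h2 := h1.eventually (gt_mem_nhds (show (0 : ℝ) < ε / 5 by positivity))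
    obtain ⟨r, h3, h4⟩ := (h2.and (Ioo_mem_nhdsLT (zero_lt_one' ℝ))).exists
    exact ⟨r, h4, h3⟩
  -- The factor `1 - r` absorbs the sum `(1 - r)⁻¹` of the geometric series.
  obtain ⟨p, hp⟩ := happrox (ε / 5 * (1 - r)) (mul_pos (by positivity) (by linarith))
  have hcoeff : ∀ k, ‖CovPoly.coeff φ k p‖ ≤ ε / 5 * (1 - r) := fun k => by
    have h1 := norm_coeff_le k (F - (p : SemicrossedProduct φ))
    rw [map_sub, h, coeff_coe, zero_sub, norm_neg] at h1
    exact h1.trans hp.le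
  have h1 := CovPoly.norm_gauge_le_of_coeff hr0.le hr1 p
    (mul_nonneg (by positivity) (by linarith)) hcoeff
  rw [mul_assoc, mul_inv_cancel₀ (by linarith), mul_one] at h1
  have h2 : ‖CovPoly.gauge φ (r : ℂ) (q - p)‖ ≤ ‖q - p‖ := by
    refine CovPoly.norm_gauge_le _ ?_ _
    rw [Complex.norm_real, Real.norm_of_nonneg hr0.le]
    exact hr1.le
  have h3 : ‖q‖ ≤ ‖q - CovPoly.gauge φ (r : ℂ) q‖ + ‖CovPoly.gauge φ (r : ℂ) (q - p)‖ +
      ‖CovPoly.gauge φ (r : ℂ) p‖ := by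
    refine le_trans (le_of_eq ?_) (norm_add₃_le (a := q - CovPoly.gauge φ (r : ℂ) q)
      (b := CovPoly.gauge φ (r : ℂ) (q - p)) (c := CovPoly.gauge φ (r : ℂ) p))
    rw [map_sub]
    congr 1
    abel
  have h4 : ‖F‖ ≤ ‖F - q‖ + ‖q‖ := by
    rw [← UniformSpace.Completion.norm_coe q]
    exact norm_le_norm_sub_add F q
  have h5 := hnorm q p
  have h6 : ε / 5 * (1 - r) ≤ ε / 5 := mul_le_of_le_one_right (by positivity) (by linarith)
  linarith

end SemicrossedProduct

/-! ### Maximum principle and factorization at an interior zero -/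

namespace diskAlgebra

/-- Maximum modulus principle for the disk algebra. -/
theorem exists_norm_eq_one_norm_le (f : diskAlgebra) (w : Metric.closedBall (0 : ℂ) 1) :
    ∃ ζ : Metric.closedBall (0 : ℂ) 1, ‖(ζ : ℂ)‖ = 1 ∧ ‖f.1 w‖ ≤ ‖f.1 ζ‖ := by
  obtain ⟨g, hg, e⟩ := f.2
  have hcl : closure (Metric.ball (0 : ℂ) 1) = Metric.closedBall 0 1 :=
    closure_ball 0 one_ne_zero
  have hcont : ContinuousOn g (Metric.closedBall (0 : ℂ) 1) := by
    rw [continuousOn_iff_continuous_domRestrict]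
    exact f.1.continuous.congr e
  obtain ⟨ζ, hζ, hmax⟩ := Complex.exists_mem_frontier_isMaxOn_norm
    (Metric.isBounded_ball (x := (0 : ℂ)) (r := 1)) (Metric.nonempty_ball.mpr one_pos)
    ⟨hg, by rwa [hcl]⟩
  rw [frontier_ball 0 one_ne_zero, mem_sphere_zero_iff_norm] at hζ
  refine ⟨⟨ζ, mem_closedBall_zero_iff.mpr hζ.le⟩, hζ, ?_⟩
  rw [e, e]
  exact hmax (by rw [hcl]; exact w.2)

/-- A nonzero function of the disk algebra is a power of `z - z₀` times a function that does not
vanish at `z₀`, for every point `z₀` of the open disc. -/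
theorem exists_eq_pow_mul {g : diskAlgebra} (hg : g ≠ 0) (z₀ : Metric.closedBall (0 : ℂ) 1)
    (hz₀ : ‖(z₀ : ℂ)‖ < 1) :
    ∃ (m : ℕ) (h : diskAlgebra), h.1 z₀ ≠ 0 ∧
      ∀ z : Metric.closedBall (0 : ℂ) 1, g.1 z = ((z : ℂ) - z₀) ^ m * h.1 z := by
  obtain ⟨G, hG, e⟩ := g.2
  have hz₀' : (z₀ : ℂ) ∈ Metric.ball (0 : ℂ) 1 := mem_ball_zero_iff.mpr hz₀
  have hnhds : Metric.ball (0 : ℂ) 1 ∈ nhds (z₀ : ℂ) := Metric.isOpen_ball.mem_nhds hz₀'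
  have hcl : closure (Metric.ball (0 : ℂ) 1) = Metric.closedBall 0 1 :=
    closure_ball 0 one_ne_zero
  have hGcont : ContinuousOn G (Metric.closedBall (0 : ℂ) 1) := by
    rw [continuousOn_iff_continuous_domRestrict]
    exact g.1.continuous.congr e
  have hGan : AnalyticOnNhd ℂ G (Metric.ball 0 1) := hG.analyticOnNhd Metric.isOpen_ball
  -- By the identity theorem, vanishing near `z₀` would force vanishing on the open disc, and by
  -- continuity on its closure.
  have hne : ¬ ∀ᶠ z in nhds (z₀ : ℂ), G z = 0 := by
    intro h0
    have h1 : Set.EqOn G 0 (Metric.ball 0 1) :=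
      hGan.eqOn_zero_of_preconnected_of_eventuallyEq_zero
        (convex_ball (0 : ℂ) 1).isPreconnected hz₀' h0
    have h2 : Set.EqOn G 0 (Metric.closedBall 0 1) :=
      h1.of_subset_closure hGcont continuousOn_const Metric.ball_subset_closedBall hcl.ge
    refine hg (Subtype.ext (ContinuousMap.ext fun z => ?_))
    rw [e]
    exact h2 z.2
  obtain ⟨m, k, hk, hk0, hGk⟩ :=
    (hGan _ hz₀').exists_eventuallyEq_pow_smul_nonzero_iff.mpr hne
  -- The quotient with its removable singularity filled in. It equals the analytic `k` near `z₀`;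
  -- elsewhere the denominator is nonzero, so regularity inside and continuity up to the boundary
  -- come from `G`.
  let K : ℂ → ℂ := Function.update (fun z => G z / (z - z₀) ^ m) z₀ (k z₀)
  have hK_ne : ∀ z : ℂ, z ≠ z₀ → K z = G z / (z - z₀) ^ m := fun z hz => Function.update_of_ne hz _ _
  have hK_self : K z₀ = k z₀ := Function.update_self _ _ _
  have hKk : K =ᶠ[nhds (z₀ : ℂ)] k := by
    filter_upwards [hGk] with z hz
    rcases eq_or_ne z z₀ with rfl | hne
    · exact hK_self
    · rw [hK_ne z hne, hz, smul_eq_mul, mul_div_cancel_left₀]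
      exact pow_ne_zero _ (sub_ne_zero.mpr hne)
  have hK_near : ∀ z, z ≠ (z₀ : ℂ) → K =ᶠ[nhds z] fun z => G z / (z - z₀) ^ m := fun z hz => by
    filter_upwards [isOpen_ne.mem_nhds hz] with w hw using hK_ne w hw
  have hKdiff : DifferentiableOn ℂ K (Metric.ball 0 1) := by
    intro z hz
    refine DifferentiableAt.differentiableWithinAt ?_
    rcases eq_or_ne z z₀ with rfl | hne
    · exact hk.differentiableAt.congr_of_eventuallyEq hKk
    · refine DifferentiableAt.congr_of_eventuallyEq ?_ (hK_near z hne)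
      exact (hG.differentiableAt (Metric.isOpen_ball.mem_nhds hz)).div (by fun_prop)
        (pow_ne_zero _ (sub_ne_zero.mpr hne))
  have hKcont : ContinuousOn K (Metric.closedBall 0 1) := by
    intro z hz
    rcases eq_or_ne z z₀ with rfl | hne
    · exact (hk.continuousAt.congr hKk.symm).continuousWithinAt
    · refine ContinuousWithinAt.congr_of_eventuallyEq ?_
        (nhdsWithin_le_nhds (hK_near z hne)) (hK_ne z hne)
      exact (hGcont z hz).div (by fun_prop) (pow_ne_zero _ (sub_ne_zero.mpr hne))
  refine ⟨m, ⟨⟨fun z => K z, continuousOn_iff_continuous_domRestrict.mp hKcont⟩, K, hKdiff,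
    fun _ => rfl⟩, ?_, fun z => ?_⟩
  · change K z₀ ≠ 0
    rwa [hK_self]
  · change g.1 z = ((z : ℂ) - z₀) ^ m * K z
    rw [e]
    rcases eq_or_ne (z : ℂ) z₀ with hz | hz
    · rw [hz, hK_self, ← smul_eq_mul]
      exact hGk.self_of_nhds
    · rw [hK_ne _ hz, mul_div_cancel₀]
      exact pow_ne_zero _ (sub_ne_zero.mpr hz)

end diskAlgebra

/-! ### Products along the iterates of an elliptic Blaschke product -/

namespace FiniteBlaschke

variable (φ : FiniteBlaschke)

/-- On the unit circle the right side of `normSq_identity` vanishes, so every Blaschke factor is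
unimodular. -/
theorem norm_toFun_eq_one {z : ℂ} (hz : ‖z‖ = 1) : ‖φ.toFun z‖ = 1 := by
  rw [toFun, norm_mul, φ.norm_u, one_mul, norm_prod]
  refine Finset.prod_eq_one fun i _ => ?_
  rw [norm_div, div_eq_one_iff_eq (norm_ne_zero_iff.mpr (denom_ne_zero (φ.norm_a_lt i) hz.le))]
  have h := normSq_identity (φ.a i) z
  rw [hz, one_pow, sub_self, mul_zero, sub_eq_zero] at h
  exact ((sq_eq_sq₀ (norm_nonneg _) (norm_nonneg _)).mp h).symm

theorem norm_selfMap_iterate {ζ : Metric.closedBall (0 : ℂ) 1} (hζ : ‖(ζ : ℂ)‖ = 1) (j : ℕ) :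
    ‖(φ.selfMap^[j] ζ : ℂ)‖ = 1 := by
  induction j with
  | zero => exact hζ
  | succ j ih =>
    rw [Function.iterate_succ_apply']
    exact φ.norm_toFun_eq_one ih

theorem endo_pow_apply (j : ℕ) (f : diskAlgebra) (z : Metric.closedBall (0 : ℂ) 1) :
    ((φ.endo ^ j) f).1 z = f.1 (φ.selfMap^[j] z) := by
  induction j generalizing f with
  | zero => rfl
  | succ j ih =>
    rw [pow_succ, AlgHom.mul_apply, ih, Function.iterate_succ_apply']
    rfl

theorem prod_endo_pow_apply (f : diskAlgebra) (k n : ℕ) (z : Metric.closedBall (0 : ℂ) 1) :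
    (∏ i ∈ Finset.range n, (φ.endo ^ (i * k)) f).1 z =
      ∏ i ∈ Finset.range n, f.1 (φ.selfMap^[i * k] z) := by
  rw [← Subalgebra.coe_val, map_prod, ContinuousMap.prod_apply]
  exact Finset.prod_congr rfl fun i _ => φ.endo_pow_apply _ f z

/-- If `φ` has a fixed point in the open disc, then the products of `g` along the iterates of `φ`
decay at most exponentially. -/
theorem IsElliptic.exists_pow_le_norm_prod {φ : FiniteBlaschke} (hφ : φ.IsElliptic)
    {g : diskAlgebra} (hg : g ≠ 0) (k : ℕ) :
    ∃ c : ℝ, 0 < c ∧ ∀ n : ℕ, c ^ n ≤ ‖∏ i ∈ Finset.range n, (φ.endo ^ (i * k)) g‖ := by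
  obtain ⟨w, hw, hfix⟩ := hφ
  let z₀ : Metric.closedBall (0 : ℂ) 1 := ⟨w, mem_closedBall_zero_iff.mpr hw.le⟩
  have hz₀ : φ.selfMap z₀ = z₀ := Subtype.ext hfix
  obtain ⟨m, h, h0, hgh⟩ := diskAlgebra.exists_eq_pow_mul hg z₀ hw
  refine ⟨(1 - ‖w‖) ^ m * ‖h.1 z₀‖,
    mul_pos (pow_pos (sub_pos.mpr hw) _) (norm_pos_iff.mpr h0), fun n => ?_⟩
  -- The maximum principle is applied to the product for `h` rather than `g`, because `g` may vanish
  -- at `z₀`. The point `ζ` depends on `n`, but the constant does not.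
  obtain ⟨ζ, hζ, hmax⟩ := diskAlgebra.exists_norm_eq_one_norm_le
    (∏ i ∈ Finset.range n, (φ.endo ^ (i * k)) h) z₀
  refine le_trans ?_ ((∏ i ∈ Finset.range n, (φ.endo ^ (i * k)) g).1.norm_coe_le_norm ζ)
  rw [prod_endo_pow_apply, prod_endo_pow_apply] at hmax
  simp only [Function.iterate_fixed hz₀, Finset.prod_const, Finset.card_range, norm_pow] at hmax
  rw [prod_endo_pow_apply, mul_pow]
  simp only [hgh, Finset.prod_mul_distrib, norm_mul]
  refine mul_le_mul ?_ hmax (by positivity) (norm_nonneg _)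
  rw [norm_prod]
  calc ((1 - ‖w‖) ^ m) ^ n = ∏ _i ∈ Finset.range n, (1 - ‖w‖) ^ m := by simp
    _ ≤ _ := Finset.prod_le_prod (fun _ _ => pow_nonneg (sub_pos.mpr hw).le _) fun i _ => by
      rw [norm_pow]
      refine pow_le_pow_left₀ (sub_pos.mpr hw).le ?_ m
      -- The iterates of `ζ` stay on the unit circle, so their distance to `w` is at least `1 -
      -- ‖w‖`.
      exact (sub_le_sub_right (φ.norm_selfMap_iterate hζ (i * k)).ge _).trans
        (norm_sub_norm_le _ _)

end FiniteBlaschke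

end

/-! ### Absence of nonzero quasinilpotents -/

theorem mainTheorem2 (φ : FiniteBlaschke) (hN : 1 < φ.N) (hφ : φ.IsElliptic)
    (F : SemicrossedProduct φ) (hF : IsQuasinilpotent F) : F = 0 := by
  classical
  by_contra hne
  have hex : ∃ k, SemicrossedProduct.coeff φ k F ≠ 0 := by
    by_contra! h
    exact hne (SemicrossedProduct.eq_zero_of_coeff_eq_zero h)
  obtain ⟨c, hc, hle⟩ := hφ.exists_pow_le_norm_prod (Nat.find_spec hex) (Nat.find hex)
  have hlow : ∀ j < Nat.find hex, SemicrossedProduct.coeff φ j F = 0 := fun j hj =>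
    not_not.mp (Nat.find_min hex hj)
  have hpow : ∀ n : ℕ, c ^ n ≤ ‖F ^ n‖ := fun n => by
    refine (hle n).trans ?_
    rw [← (SemicrossedProduct.coeff_pow hlow n).2]
    exact SemicrossedProduct.norm_coeff_le _ _
  refine absurd (ge_of_tendsto hF ?_) (not_le.mpr hc)
  -- The index `n = 0` is excluded because `1 / 0 = 0` as an exponent, which does not recover `c`
  -- from `c ^ n`.
  filter_upwards [Filter.eventually_ge_atTop 1] with n hn
  have hn' : n ≠ 0 := by omega
  calc c = (c ^ n) ^ (1 / (n : ℝ)) := by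
        rw [one_div, Real.pow_rpow_inv_natCast hc.le hn']
    _ ≤ ‖F ^ n‖ ^ (1 / (n : ℝ)) := Real.rpow_le_rpow (by positivity) (hpow n) (by positivity)
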